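/- Let $F$ be a number field, $v$ a finite place of $F$, $G_v\subset G_F=\mathrm{Gal}(\overline F/F)$ a decomposition group at $v$ with inertia subgroup $I_v$, and $q=\#(\mathcal{O}_F/v)$. Let $K$ be a number field and $\lambda$ a prime of $K$ over the rational prime $\ell$, with $v\nmid\ell$; write $K_\lambda$ for the completion, $k_\lambda$ for its residue field, $\overline{K}_\lambda$, $\bar k_\lambda$ for algebraic closures, and fix a reduction map from the integers of $\overline{K}_\lambda$ to $\bar k_\lambda$ extending that of $K_\lambda$. Let $\varepsilon$ be the $\ell$-adic cyclotomic character and $\bar\varepsilon$ its reduction. Let $\rho\colon G_F\to \mathrm{GL}_2(K_\lambda)$ be a continuous representation (for example the representation $\rho_{f,\lambda}$ attached to a Hilbert newform $f$ over $F$ with $K=K_f$), and let $\bar\rho\colon G_F\to\mathrm{GL}_2(k_\lambda)$ be a residual representation of $\rho$, i.e. a continuous representation with the same semisimplification as the reduction of a $G_F$-stable lattice (for example that reduction itself, or its semisimplification). Suppose that, over $\overline{K}_\lambda$, $$\rho|_{G_v}\cong\begin{pmatrix}\varepsilon\chi & *\\ 0&\chi\end{pmatrix}$$ is a nonsplit extension,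 for a character $\chi\colon G_v\to\overline{K}_\lambda^\times$ (the special case), and that $q^2\not\equiv 1 \bmod \lambda$. Then $\chi$ has values in the units of the ring of integers of $\overline{K}_\lambda$, and, with $\bar\chi$ its reduction, $$\bar\rho|_{G_v}\otimes\bar k_\lambda\cong\begin{pmatrix}\bar\varepsilon\bar\chi&\nu\\0&\bar\chi\end{pmatrix}$$ for some $\nu$. Moreover, in every such form, $\nu$ is ramified unless it is trivial: if the extension class in $H^1(G_v,\bar k_\lambda(1))$ given by $\nu\bar\chi^{-1}$ is nonzero, then its restriction to $I_v$ is nonzero. -/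

import Mathlib

open NumberField IsDedekindDomain
open scoped Pointwise

noncomputable section

namespace SpecialReduction

section Galois

variable (F : Type*) [Field F]

/-- The absolute Galois group `G_F`, with its Krull topology. -/
abbrev AbsGal : Type _ := AlgebraicClosure F ≃ₐ[F] AlgebraicClosure F

variable {F}

/-- The decomposition group in `G_F` of a prime `w` of the ring of all algebraic integers of the
algebraic closure of `F`. If `w` lies over the finite place `v` of `F`, this is a decomposition
group `G_v ⊆ G_F` at `v`. -/
abbrev decompositionGroup (w : Ideal (𝓞 (AlgebraicClosure F))) : Subgroup (AbsGal F) :=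
  MulAction.stabilizer (AbsGal F) w

/-- The inertia group: all `σ` in the decomposition group with `σ x ≡ x mod w` for every algebraic
integer `x`. -/
abbrev inertiaGroup (w : Ideal (𝓞 (AlgebraicClosure F))) : Subgroup (decompositionGroup w) :=
  w.toAddSubgroup.inertia (decompositionGroup w)

/-- The `ℓ`-adic cyclotomic character `ε` of `G_F`. -/
def cyclotomic (F : Type*) [Field F] (ℓ : ℕ) [Fact ℓ.Prime] : AbsGal F →* ℤ_[ℓ]ˣ :=
  (cyclotomicCharacter (AlgebraicClosure F) ℓ).comp
    (MulSemiringAction.toRingAut (AbsGal F) (AlgebraicClosure F))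

end Galois

section Coefficients

variable {K : Type*} [Field K] [NumberField K] (l : HeightOneSpectrum (𝓞 K))

/-- The completion of `K` at the prime `l`. -/
abbrev Compl : Type _ := l.adicCompletion K

/-- The ring of integers of the completion. -/
abbrev Integers : Type _ := l.adicCompletionIntegers K

/-- The residue field of the completion (canonically the residue field of `𝓞 K` at `l`). -/
abbrev Residue : Type _ := IsLocalRing.ResidueField (Integers l)

/-- An algebraic closure of the completion. -/
abbrev ComplBar : Type _ := AlgebraicClosure (Compl l)

/-- The ring of integers of the algebraic closure of the completion. -/
abbrev IntegersBar : Type _ := integralClosure (Integers l) (ComplBar l)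

/-- An algebraic closure of the residue field. -/
abbrev ResidueBar : Type _ := AlgebraicClosure (Residue l)

/-- `red` is a reduction map from the integers of the algebraic closure of the completion to the
algebraic closure of the residue field, extending the reduction map of the completion. -/
def IsReductionMap (red : IntegersBar l →+* ResidueBar l) : Prop :=
  ∀ x : Integers l, red (algebraMap (Integers l) (IntegersBar l) x) =
    algebraMap (Residue l) (ResidueBar l) (IsLocalRing.residue (Integers l) x)

variable {l}

/-- `ρ₀` is an integral model of `ρ`, that is, the matrix form of the action of `G` on a
`G`-stable lattice in the space of `ρ`. -/
def IsIntegralModel {G : Type*} [Group G] (ρ : G →* GL (Fin 2) (Compl l))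
    (ρ₀ : G →* GL (Fin 2) (Integers l)) : Prop :=
  ∃ Q : GL (Fin 2) (Compl l), ∀ g : G,
    Matrix.GeneralLinearGroup.map (algebraMap (Integers l) (Compl l)) (ρ₀ g) = Q * ρ g * Q⁻¹

/-- `ρbar` is a residual representation of `ρ`: it is continuous (the residue field being
discrete, this means that the kernel is open), and it has the same semisimplification as the
reduction of some stable lattice of `ρ`, that is, the same characteristic polynomials. The
reduction of any stable lattice is of this kind, and so is its semisimplification. -/
def IsResidual {G : Type*} [Group G] [TopologicalSpace G] (ρ : G →* GL (Fin 2) (Compl l))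
    (ρbar : G →* GL (Fin 2) (Residue l)) : Prop :=
  IsOpen (ρbar.ker : Set G) ∧
  ∃ ρ₀ : G →* GL (Fin 2) (Integers l), IsIntegralModel ρ ρ₀ ∧
    ∀ g : G, (ρbar g).val.charpoly =
      (Matrix.GeneralLinearGroup.map (IsLocalRing.residue (Integers l)) (ρ₀ g)).val.charpoly

end Coefficients

section Extensions

variable {H L : Type*} [Group H] [Field L]

/-- In a suitable basis, `σ` is given by the matrices with first row `α, ν` and second row
`0, β`. -/
def HasForm (σ : H →* GL (Fin 2) L) (α β : H →* Lˣ) (ν : H → L) : Prop :=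
  ∃ P : GL (Fin 2) L, ∀ g : H,
    (P * σ g * P⁻¹).val = !![(α g : L), ν g; 0, (β g : L)]

/-- The restriction to the subgroup `I` of the extension of `β` by `α` given by `ν` splits.
Equivalently, the restriction to `I` of the cocycle `ν β⁻¹` with values in `α β⁻¹` is a
coboundary. -/
def SplitsOn (I : Subgroup H) (α β : H →* Lˣ) (ν : H → L) : Prop :=
  ∃ t : L, ∀ g ∈ I, ν g = t * ((α g : L) - (β g : L))

end Extensions

end SpecialReduction

end

/-
A stable lattice shows that `χ` is integral and that `ρbar|G_v` has semisimplification
`εbar χbar ⊕ χbar`. Let `φ` be a Frobenius element of `G_v`. As `q ≠ 1` in the residue field, the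
eigenvalues `q χbar(φ)` and `χbar(φ)` of `ρbar(φ)` are distinct, and in a basis of eigenvectors of
`φ` the group `G_v` acts by triangular matrices, with an off-diagonal entry `ν` vanishing at `φ`.
If the diagonal characters come in the wrong order, then `ν(φ τ φ⁻¹) = q⁻¹ ν(τ)` for `τ` in the
inertia group. On the other hand `φ τ φ⁻¹` equals `τ ^ q` up to wild inertia, whose image at any
finite level has order prime to `ℓ`, so that `ν(φ τ φ⁻¹) = q ν(τ)`. As `q² ≠ 1`, `ν` vanishes on
inertia. Since `φ`, inertia and an open subgroup generate `G_v`, it vanishes everywhere, and then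
the order of the two characters can be interchanged.
For the second claim, a coboundary makes `ν` vanish at `φ`, because `q ≠ 1`; if the class is
moreover trivial on inertia, then `ν` vanishes on inertia, hence everywhere.
-/

namespace SpecialReduction

section Tame

variable {R H : Type*} [CommRing R] [Group H] [MulSemiringAction H R] {P : Ideal R} {σ τ : H}

theorem smul_mem_pow_of_mem_stabilizer (hσ : σ ∈ MulAction.stabilizer H P) {n : ℕ} {z : R}
    (hz : z ∈ P ^ n) : σ • z ∈ P ^ n := by
  have h := Ideal.mem_map_of_mem (MulSemiringAction.toRingHom H R σ) hz
  rwa [Ideal.map_pow, ← Ideal.pointwise_smul_def, MulAction.mem_stabilizer_iff.mp hσ] at h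

theorem smul_mem_of_mem_stabilizer (hσ : σ ∈ MulAction.stabilizer H P) {z : R} (hz : z ∈ P) :
    σ • z ∈ P := by
  simpa only [pow_one] using
    smul_mem_pow_of_mem_stabilizer (n := 1) hσ (by simpa only [pow_one] using hz)

theorem smul_mem_iff_of_mem_stabilizer (hσ : σ ∈ MulAction.stabilizer H P) {z : R} :
    σ • z ∈ P ↔ z ∈ P :=
  ⟨fun h ↦ by simpa only [inv_smul_smul] using smul_mem_of_mem_stabilizer (inv_mem hσ) h,
    smul_mem_of_mem_stabilizer hσ⟩

theorem conj_mem_inertia (hσ : σ ∈ MulAction.stabilizer H P) (hτ : τ ∈ P.inertia H) :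
    σ * τ * σ⁻¹ ∈ P.inertia H := fun x ↦ by
  simpa [smul_sub, mul_smul] using smul_mem_of_mem_stabilizer hσ (hτ (σ⁻¹ • x))

/-- `τ` acts on the cotangent space `P / P ^ 2` as multiplication by `θ`. For `τ` in the inertia
group, the class of `θ` modulo `P` is the value at `τ` of the tame character. -/
def ActsOnCotangentBy (P : Ideal R) (τ : H) (θ : R) : Prop :=
  ∀ z ∈ P, τ • z - θ * z ∈ P ^ 2

theorem ActsOnCotangentBy.one : ActsOnCotangentBy P (1 : H) 1 := fun z _ ↦ by simp

theorem ActsOnCotangentBy.mul {θ η : R} (hσ : ActsOnCotangentBy P σ θ)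
    (hτ : ActsOnCotangentBy P τ η) (hτP : τ ∈ MulAction.stabilizer H P) :
    ActsOnCotangentBy P (σ * τ) (θ * η) := fun z hz ↦ by
  have expand : (σ * τ) • z - θ * η * z = (σ • τ • z - θ * τ • z) + θ * (τ • z - η * z) := by
    rw [mul_smul]; ring
  rw [expand]
  exact add_mem (hσ _ (smul_mem_of_mem_stabilizer hτP hz)) (Ideal.mul_mem_left _ _ (hτ z hz))

theorem ActsOnCotangentBy.pow {θ : R} (hτ : ActsOnCotangentBy P τ θ)
    (hτP : τ ∈ MulAction.stabilizer H P) (n : ℕ) : ActsOnCotangentBy P (τ ^ n) (θ ^ n) := by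
  induction n with
  | zero => simpa only [pow_zero] using ActsOnCotangentBy.one
  | succ n ih => simpa only [pow_succ] using ih.mul hτ hτP

theorem ActsOnCotangentBy.conj {θ η : R} (hτ : ActsOnCotangentBy P τ θ)
    (hσP : σ ∈ MulAction.stabilizer H P) (hσ : σ • θ - η ∈ P) :
    ActsOnCotangentBy P (σ * τ * σ⁻¹) η := fun z hz ↦ by
  have expand : (σ * τ * σ⁻¹) • z - η * z =
      σ • (τ • σ⁻¹ • z - θ * σ⁻¹ • z) + (σ • θ - η) * z := by
    rw [smul_sub, smul_mul', smul_inv_smul, mul_smul, mul_smul]; ring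
  rw [expand]
  refine add_mem (smul_mem_pow_of_mem_stabilizer hσP
    (hτ _ (smul_mem_of_mem_stabilizer (inv_mem hσP) hz))) ?_
  exact pow_two P ▸ Ideal.mul_mem_mul hσ hz

theorem ActsOnCotangentBy.mul_inv {θ : R} (hσ : ActsOnCotangentBy P σ θ)
    (hτ : ActsOnCotangentBy P τ θ) (hτP : τ ∈ MulAction.stabilizer H P) :
    ActsOnCotangentBy P (σ * τ⁻¹) 1 := fun z hz ↦ by
  have hz' := smul_mem_of_mem_stabilizer (inv_mem hτP) hz
  simpa [mul_smul] using sub_mem (hσ _ hz') (hτ _ hz')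

theorem exists_actsOnCotangentBy [IsDedekindDomain R] [P.IsPrime] (hP : P ≠ ⊥)
    (hτ : τ ∈ P.inertia H) : ∃ θ : R, ActsOnCotangentBy P τ θ := by
  have hτP := Ideal.inertia_le_stabilizer P hτ
  obtain ⟨π, hπ, hπ'⟩ := SetLike.exists_of_lt (Ideal.pow_succ_lt_pow hP 1)
  obtain ⟨θ, e, he, hθ⟩ := Ideal.exists_mul_add_mem_pow_succ hP π (τ • π) hπ hπ'
    (smul_mem_pow_of_mem_stabilizer hτP hπ)
  refine ⟨θ, fun z hz ↦ ?_⟩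
  obtain ⟨a, f, hf, rfl⟩ :=
    Ideal.exists_mul_add_mem_pow_succ hP π z hπ hπ' (by simpa only [pow_one] using hz)
  have expand : τ • (π * a + f) - θ * (π * a + f) =
      τ • π * (τ • a - a) + a * e + τ • f - θ * f := by
    rw [smul_add, smul_mul', ← hθ]; ring
  rw [expand]
  have hπa : τ • π * (τ • a - a) ∈ P ^ 2 := pow_two P ▸
    Ideal.mul_mem_mul (smul_mem_of_mem_stabilizer hτP (by simpa only [pow_one] using hπ)) (hτ a)
  exact sub_mem (add_mem (add_mem hπa (Ideal.mul_mem_left _ _ he))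
    (smul_mem_pow_of_mem_stabilizer hτP hf)) (Ideal.mul_mem_left _ _ hf)

/-- The wild inertia group of `P`: all elements acting trivially both on `R / P` and on
`P / P ^ 2`. -/
def wildInertia (P : Ideal R) (H : Type*) [Group H] [MulSemiringAction H R] : Subgroup H where
  carrier := {τ | τ ∈ P.inertia H ∧ ActsOnCotangentBy P τ 1}
  one_mem' := ⟨one_mem _, .one⟩
  mul_mem' hσ hτ := ⟨mul_mem hσ.1 hτ.1,
    by simpa only [mul_one] using hσ.2.mul hτ.2 (Ideal.inertia_le_stabilizer P hτ.1)⟩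
  inv_mem' hτ := ⟨inv_mem hτ.1,
    by simpa only [one_mul] using
      ActsOnCotangentBy.one.mul_inv hτ.2 (Ideal.inertia_le_stabilizer P hτ.1)⟩

theorem conj_mul_pow_inv_mem_wildInertia [IsDedekindDomain R] [P.IsPrime] (hP : P ≠ ⊥)
    (hσ : σ ∈ MulAction.stabilizer H P) {q : ℕ} (hσq : ∀ x : R, σ • x - x ^ q ∈ P)
    (hτ : τ ∈ P.inertia H) : σ * τ * σ⁻¹ * (τ ^ q)⁻¹ ∈ wildInertia P H := by
  have hτP := Ideal.inertia_le_stabilizer P hτ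
  obtain ⟨θ, hθ⟩ := exists_actsOnCotangentBy hP hτ
  exact ⟨mul_mem (conj_mem_inertia hσ hτ) (inv_mem (pow_mem hτ q)),
    (hθ.conj hσ (hσq θ)).mul_inv (hθ.pow hτP q) (pow_mem hτP q)⟩

theorem smul_sub_mem_pow_succ_of_mem_wildInertia (hτ : τ ∈ wildInertia P H) {n : ℕ} {z : R}
    (hz : z ∈ P ^ n) : τ • z - z ∈ P ^ (n + 1) := by
  have hτP := Ideal.inertia_le_stabilizer P hτ.1
  induction n generalizing z with
  | zero => simpa using hτ.1 z
  | succ n ih =>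
    rw [pow_succ] at hz
    refine Submodule.mul_induction_on hz (fun a ha b hb ↦ ?_) fun a b ha hb ↦ ?_
    · have expand : τ • (a * b) - a * b = τ • a * (τ • b - b) + (τ • a - a) * b := by
        rw [smul_mul']; ring
      have hb' : τ • b - b ∈ P ^ 2 := by simpa only [one_mul] using hτ.2 b hb
      rw [expand]
      refine add_mem ?_ (pow_succ P (n + 1) ▸ Ideal.mul_mem_mul (ih ha) hb)
      rw [add_assoc, pow_add]
      exact Ideal.mul_mem_mul (smul_mem_pow_of_mem_stabilizer hτP ha) hb'
    · rw [smul_add, add_sub_add_comm]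
      exact add_mem ha hb

theorem pow_smul_sub_sub_mem_of_mem_wildInertia (hτ : τ ∈ wildInertia P H) {n : ℕ} {x : R}
    (hx : τ • x - x ∈ P ^ n) (k : ℕ) : τ ^ k • x - x - k * (τ • x - x) ∈ P ^ (n + 1) := by
  induction k with
  | zero => simp
  | succ k ih =>
    have expand : τ ^ (k + 1) • x - x - ((k + 1 : ℕ) : R) * (τ • x - x) =
        τ • (τ ^ k • x - x - k * (τ • x - x)) + k * (τ • (τ • x - x) - (τ • x - x)) := by
      have hk : τ • (k : R) = k := map_natCast (MulSemiringAction.toRingHom H R τ) k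
      rw [pow_succ', mul_smul, smul_sub, smul_sub, smul_mul', smul_sub, hk]
      push_cast
      ring
    rw [expand]
    exact add_mem (smul_mem_pow_of_mem_stabilizer (Ideal.inertia_le_stabilizer P hτ.1) ih)
      (Ideal.mul_mem_left _ _ (smul_sub_mem_pow_succ_of_mem_wildInertia hτ hx))

theorem smul_eq_of_mem_wildInertia_of_pow_eq_one [IsDomain R] [IsNoetherianRing R]
    [P.IsMaximal] (hτ : τ ∈ wildInertia P H) {n : ℕ} (hn : (n : R) ∉ P) (hτn : τ ^ n = 1) (x : R) :
    τ • x = x := by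
  have mem_pow (m : ℕ) : τ • x - x ∈ P ^ m := by
    induction m with
    | zero => simp
    | succ m ih =>
      have h := pow_smul_sub_sub_mem_of_mem_wildInertia hτ ih n
      rw [hτn, one_smul, sub_self, zero_sub, neg_mem_iff] at h
      exact (Ideal.IsMaximal.mul_mem_pow P h).resolve_left hn
  have mem_iInf : τ • x - x ∈ ⨅ m, P ^ m := Submodule.mem_iInf _ |>.mpr mem_pow
  rw [Ideal.iInf_pow_eq_bot_of_isDomain P Ideal.IsPrime.ne_top'] at mem_iInf
  exact sub_eq_zero.mp mem_iInf

theorem not_dvd_orderOf_of_mem_wildInertia [IsDomain R] [IsNoetherianRing R] [P.IsMaximal]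
    [FaithfulSMul H R] [Finite H] (hτ : τ ∈ wildInertia P H) {ℓ : ℕ} (hℓ : ℓ ≠ 1)
    (hℓP : (ℓ : R) ∉ P) : ¬ ℓ ∣ orderOf τ := fun hdvd ↦ by
  have horder := orderOf_pow_orderOf_div (orderOf_pos τ).ne' hdvd
  have htrivial : τ ^ (orderOf τ / ℓ) = 1 := FaithfulSMul.eq_of_smul_eq_smul (α := R) fun x ↦ by
    rw [one_smul]
    exact smul_eq_of_mem_wildInertia_of_pow_eq_one (pow_mem hτ _) hℓP
      (by rw [← pow_mul, Nat.div_mul_cancel hdvd, pow_orderOf_eq_one]) x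
  exact hℓ (by rw [← horder, htrivial, orderOf_one])

end Tame

section Frobenius

variable {R S G : Type*} [CommRing R] [CommRing S] [Algebra R S] [Group G] [MulSemiringAction G S]
  [SMulCommClass G R S] {Q : Ideal S}

theorem pow_smul_sub_pow_mem_of_isArithFrobAt {φ : G} (hφ : IsArithFrobAt R φ Q) (n : ℕ) (x : S) :
    φ ^ n • x - x ^ Nat.card (R ⧸ Q.under R) ^ n ∈ Q := by
  induction n generalizing x with
  | zero => simp
  | succ n ih =>
    rw [pow_succ, mul_smul, pow_succ', pow_mul]
    have h := Q.mem_of_dvd (sub_dvd_pow_sub_pow (φ • x) (x ^ Nat.card (R ⧸ Q.under R))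
      (Nat.card (R ⧸ Q.under R) ^ n)) (hφ x)
    simpa only [sub_add_sub_cancel] using add_mem (ih (φ • x)) h

theorem isMaximal_under_of_finite_quotient [Q.IsPrime] [Finite (R ⧸ Q.under R)] :
    (Q.under R).IsMaximal :=
  Ideal.Quotient.maximal_of_isField _ (Finite.isField_of_domain _)

theorem exists_smul_sub_pow_card_pow_mem [Q.IsPrime] [Finite (S ⧸ Q)] {σ : G}
    (hσ : σ ∈ MulAction.stabilizer G Q) :
    ∃ n : ℕ, ∀ x : S, σ • x - x ^ Nat.card (R ⧸ Q.under R) ^ n ∈ Q := by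
  have : Finite (R ⧸ Q.under R) := .of_injective _ (Ideal.algebraMap_quotient_injective (I := Q))
  have : (Q.under R).IsMaximal := isMaximal_under_of_finite_quotient
  have : Q.IsMaximal := Ideal.Quotient.maximal_of_isField _ (Finite.isField_of_domain _)
  let _ := Ideal.Quotient.field (Q.under R)
  let _ := Ideal.Quotient.field Q
  let _ := Fintype.ofFinite (R ⧸ Q.under R)
  obtain ⟨n, hn⟩ := (FiniteField.bijective_frobeniusAlgEquivOfAlgebraic_pow
    (R ⧸ Q.under R) (S ⧸ Q)).2 (Ideal.Quotient.stabilizerHom Q (Q.under R) G ⟨σ, hσ⟩)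
  refine ⟨n, fun x ↦ ?_⟩
  have h := DFunLike.congr_fun hn (Ideal.Quotient.mk Q x)
  simp only [AlgEquiv.coe_pow, FiniteField.coe_frobeniusAlgEquivOfAlgebraic, pow_iterate,
    Fintype.card_eq_nat_card] at h
  rw [Ideal.Quotient.stabilizerHom_apply, ← map_pow] at h
  exact Ideal.Quotient.eq.mp h.symm

section Profinite

variable [Algebra.IsInvariant R S G] [TopologicalSpace G] [CompactSpace G]
  [TotallyDisconnectedSpace G] [IsTopologicalGroup G]

theorem exists_mem_stabilizer_mk_smul_eq
    (hopen : ∀ x : S, IsOpen (MulAction.stabilizer G x : Set G)) [Q.IsPrime]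
    (e : (S ⧸ Q) ≃ₐ[R ⧸ Q.under R] S ⧸ Q) :
    ∃ g ∈ MulAction.stabilizer G Q, ∀ x : S,
      Ideal.Quotient.mk Q (g • x) = e (Ideal.Quotient.mk Q x) := by
  let _ : TopologicalSpace S := ⊥
  have : DiscreteTopology S := ⟨rfl⟩
  have : ContinuousSMul G S := continuousSMul_iff_stabilizer_isOpen.mpr hopen
  obtain ⟨g, rfl⟩ := Ideal.Quotient.stabilizerHom_surjective_of_profinite (G := G) (Q.under R) Q e
  exact ⟨g, g.2, fun x ↦ rfl⟩

theorem exists_isArithFrobAt (hopen : ∀ x : S, IsOpen (MulAction.stabilizer G x : Set G))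
    [Algebra.IsIntegral R S] (Q : Ideal S) [Q.IsPrime] [Finite (R ⧸ Q.under R)] :
    ∃ φ : G, IsArithFrobAt R φ Q := by
  have : (Q.under R).IsMaximal := isMaximal_under_of_finite_quotient
  have : Q.IsMaximal := Ideal.isMaximal_of_isIntegral_of_isMaximal_comap (R := R) Q ‹_›
  let _ := Ideal.Quotient.field (Q.under R)
  let _ := Ideal.Quotient.field Q
  let _ := Fintype.ofFinite (R ⧸ Q.under R)
  obtain ⟨φ, -, h⟩ := exists_mem_stabilizer_mk_smul_eq (R := R) (G := G) hopen
    (FiniteField.frobeniusAlgEquivOfAlgebraic (R ⧸ Q.under R) (S ⧸ Q))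
  refine ⟨φ, fun x ↦ ?_⟩
  rw [← Ideal.Quotient.eq]
  simpa using h x

end Profinite

end Frobenius

section RingOfIntegers

variable {k L H : Type*} [Field k] [Field L] [Algebra k L] [Group H] [MulSemiringAction H L]

instance smulCommClass_ringOfIntegers [SMulCommClass H k L] :
    SMulCommClass H (𝓞 k) (𝓞 L) where
  smul_comm g a x := RingOfIntegers.coe_injective <| by
    have h : g • (algebraMap k L a * x) = algebraMap k L a * g • (x : L) := by
      rw [smul_mul', smul_algebraMap]
    exact h

instance isInvariant_ringOfIntegers [Algebra.IsInvariant k L H] :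
    Algebra.IsInvariant (𝓞 k) (𝓞 L) H where
  isInvariant b hb := by
    obtain ⟨a, ha⟩ := Algebra.IsInvariant.isInvariant (A := k) (G := H) (b : L)
      fun g ↦ congrArg (algebraMap (𝓞 L) L) (hb g)
    have hint : IsIntegral ℤ a := (isIntegral_algebraMap_iff (algebraMap k L).injective).mp
      (ha ▸ RingOfIntegers.isIntegral_coe b)
    exact ⟨⟨a, hint⟩, RingOfIntegers.ext ha⟩

theorem isOpen_stabilizer_ringOfIntegers [TopologicalSpace H]
    (hopen : ∀ x : L, IsOpen (MulAction.stabilizer H x : Set H)) (x : 𝓞 L) :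
    IsOpen (MulAction.stabilizer H x : Set H) := by
  convert hopen (x : L) using 2
  ext g
  exact RingOfIntegers.ext_iff

end RingOfIntegers

section Decomposition

variable {F : Type*} [Field F] {w : Ideal (𝓞 (AlgebraicClosure F))}

theorem exists_frobenius_mem_decompositionGroup [NumberField F] [w.IsPrime]
    (hw : w.under (𝓞 F) ≠ ⊥) :
    ∃ φ : decompositionGroup (F := F) w, IsArithFrobAt (𝓞 F) (φ : AbsGal F) w := by
  have : Finite (𝓞 F ⧸ w.under (𝓞 F)) := Ideal.finiteQuotientOfFreeOfNeBot _ hw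
  have : Algebra.IsInvariant F (AlgebraicClosure F) (AbsGal F) := IsGaloisGroup.isInvariant
  obtain ⟨φ, hφ⟩ := exists_isArithFrobAt (R := 𝓞 F) (G := AbsGal F)
    (isOpen_stabilizer_ringOfIntegers stabilizer_isOpen_of_isIntegral) w
  exact ⟨⟨φ, hφ.mem_stabilizer⟩, hφ⟩

theorem exists_fixingSubgroup_mem_of_isOpen {D : Subgroup (AbsGal F)} {N : Subgroup D}
    (hN : IsOpen (N : Set D)) :
    ∃ E : IntermediateField F (AlgebraicClosure F), FiniteDimensional F E ∧ Normal F E ∧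
      ∀ u : D, (u : AbsGal F) ∈ E.fixingSubgroup → u ∈ N := by
  obtain ⟨U, hU, hUN⟩ := mem_nhds_subtype _ _ _ |>.mp (hN.mem_nhds (one_mem N))
  obtain ⟨E, hE, hEn, hEU⟩ := (krullTopology_mem_nhds_one_iff_of_normal F _ U).mp hU
  exact ⟨E, hE, hEn, fun u hu ↦ hUN (hEU hu)⟩

theorem exists_mem_fixingSubgroup_smul_sub_smul_mem [CharZero F] [w.IsPrime]
    (E : IntermediateField F (AlgebraicClosure F)) [FiniteDimensional F E]
    {g : AbsGal F} (hg : g ∈ decompositionGroup w)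
    (hgE : ∀ x : 𝓞 E, g • algebraMap (𝓞 E) (𝓞 (AlgebraicClosure F)) x -
      algebraMap (𝓞 E) (𝓞 (AlgebraicClosure F)) x ∈ w) :
    ∃ u ∈ decompositionGroup w, u ∈ E.fixingSubgroup ∧
      ∀ x : 𝓞 (AlgebraicClosure F), u • x - g • x ∈ w := by
  have : Algebra.IsInvariant E (AlgebraicClosure F) E.fixingSubgroup := ⟨fun b hb ↦ by
    have hb : b ∈ IntermediateField.fixedField E.fixingSubgroup := hb
    rw [InfiniteGalois.fixedField_fixingSubgroup] at hb
    exact ⟨⟨b, hb⟩, rfl⟩⟩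
  have : CompactSpace E.fixingSubgroup :=
    isCompact_iff_compactSpace.mp E.fixingSubgroup_isClosed.isCompact
  have : SMulCommClass E.fixingSubgroup E (AlgebraicClosure F) := ⟨fun u a x ↦ by
    have hu : u • (a : AlgebraicClosure F) = a := u.2 a
    simp only [Algebra.smul_def, smul_mul', IntermediateField.algebraMap_apply, hu]⟩
  let e : (𝓞 (AlgebraicClosure F) ⧸ w) ≃ₐ[𝓞 E ⧸ w.under (𝓞 E)] 𝓞 (AlgebraicClosure F) ⧸ w :=
    { Ideal.quotientEquiv w w (MulSemiringAction.toRingEquiv (AbsGal F) _ g) hg.symm with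
      commutes' := by
        rintro ⟨x⟩
        exact Ideal.Quotient.eq.mpr (hgE x) }
  obtain ⟨u, hu, h⟩ := exists_mem_stabilizer_mk_smul_eq (R := 𝓞 E) (G := E.fixingSubgroup)
    (isOpen_stabilizer_ringOfIntegers fun x ↦
      (stabilizer_isOpen_of_isIntegral (K := F) x).preimage continuous_subtype_val) e
  exact ⟨u, hu, u.2, fun x ↦ Ideal.Quotient.eq.mp (h x)⟩

section FiniteLevel

variable (E : IntermediateField F (AlgebraicClosure F))

theorem under_ringOfIntegers_ne_bot (hw : w.under (𝓞 F) ≠ ⊥) : w.under (𝓞 E) ≠ ⊥ := fun h ↦ hw <| by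
  rw [← Ideal.under_under (A := 𝓞 F) (B := 𝓞 E), h, Ideal.under_bot]

variable [Normal F E]

theorem algebraMap_restrictNormalHom_smul (g : AbsGal F) (x : 𝓞 E) :
    algebraMap (𝓞 E) (𝓞 (AlgebraicClosure F)) (AlgEquiv.restrictNormalHom E g • x) =
      g • algebraMap (𝓞 E) (𝓞 (AlgebraicClosure F)) x :=
  RingOfIntegers.coe_injective <|
    AlgEquiv.restrictNormal_commutes (χ := g) (E := E) (algebraMap (𝓞 E) E x)

theorem restrictNormalHom_mem_stabilizer {g : AbsGal F} (hg : g ∈ decompositionGroup w) :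
    AlgEquiv.restrictNormalHom E g ∈ MulAction.stabilizer (E ≃ₐ[F] E) (w.under (𝓞 E)) := by
  refine MulAction.mem_stabilizer_iff.mpr (Ideal.ext fun x ↦ ?_)
  rw [Ideal.mem_pointwise_smul_iff_inv_smul_mem, ← map_inv, Ideal.mem_comap, Ideal.mem_comap,
    algebraMap_restrictNormalHom_smul, smul_mem_iff_of_mem_stabilizer (inv_mem hg)]

variable [NumberField F] [FiniteDimensional F E]

theorem exists_smul_sub_pow_smul_mem [w.IsPrime] (hw : w.under (𝓞 F) ≠ ⊥)
    {φ : AbsGal F} (hφ : IsArithFrobAt (𝓞 F) φ w) {g : AbsGal F} (hg : g ∈ decompositionGroup w) :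
    ∃ n : ℕ, ∀ x : 𝓞 E, g • algebraMap (𝓞 E) (𝓞 (AlgebraicClosure F)) x -
      φ ^ n • algebraMap (𝓞 E) (𝓞 (AlgebraicClosure F)) x ∈ w := by
  have : NumberField E := NumberField.of_module_finite F E
  have : Finite (𝓞 E ⧸ w.under (𝓞 E)) :=
    Ideal.finiteQuotientOfFreeOfNeBot _ (under_ringOfIntegers_ne_bot E hw)
  obtain ⟨n, hn⟩ := exists_smul_sub_pow_card_pow_mem (R := 𝓞 F)
    (restrictNormalHom_mem_stabilizer E hg)
  rw [Ideal.under_under] at hn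
  refine ⟨n, fun x ↦ ?_⟩
  have h := Ideal.mem_comap.mp (hn x)
  rw [map_sub, map_pow, algebraMap_restrictNormalHom_smul] at h
  simpa only [sub_sub_sub_cancel_right] using
    sub_mem h (pow_smul_sub_pow_mem_of_isArithFrobAt hφ n (algebraMap (𝓞 E) _ x))

theorem not_dvd_orderOf_restrictNormalHom [w.IsPrime] (hw : w.under (𝓞 F) ≠ ⊥)
    {φ τ : AbsGal F} (hφ : IsArithFrobAt (𝓞 F) φ w) (hτ : τ ∈ w.toAddSubgroup.inertia (AbsGal F))
    {ℓ : ℕ} (hℓ : ℓ ≠ 1) (hℓw : (ℓ : 𝓞 (AlgebraicClosure F)) ∉ w) :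
    ¬ ℓ ∣ orderOf (AlgEquiv.restrictNormalHom E
      (φ * τ * φ⁻¹ * (τ ^ Nat.card (𝓞 F ⧸ w.under (𝓞 F)))⁻¹)) := by
  have : NumberField E := NumberField.of_module_finite F E
  have hE := under_ringOfIntegers_ne_bot E hw
  have : (w.under (𝓞 E)).IsMaximal := Ideal.IsPrime.isMaximal inferInstance hE
  have : IsGalois F E := {}
  have : FaithfulSMul (E ≃ₐ[F] E) (𝓞 E) :=
    (inferInstance : IsGaloisGroup (E ≃ₐ[F] E) (𝓞 F) (𝓞 E)).faithful
  refine not_dvd_orderOf_of_mem_wildInertia (P := w.under (𝓞 E)) ?_ hℓ fun h ↦ hℓw ?_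
  · rw [map_mul, map_mul, map_mul, map_inv, map_inv, map_pow]
    refine conj_mul_pow_inv_mem_wildInertia hE
      (restrictNormalHom_mem_stabilizer E hφ.mem_stabilizer) (fun x ↦ ?_) fun x ↦ ?_
    · rw [Ideal.mem_comap, map_sub, map_pow, algebraMap_restrictNormalHom_smul]
      exact hφ _
    · rw [Submodule.mem_toAddSubgroup, Ideal.mem_comap, map_sub, algebraMap_restrictNormalHom_smul]
      exact hτ _
  · simpa only [Ideal.mem_comap, map_natCast] using h

end FiniteLevel

variable [NumberField F] [w.IsPrime] {φ : decompositionGroup (F := F) w}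
  {N : Subgroup (decompositionGroup (F := F) w)}

theorem zpowers_sup_inertiaGroup_sup_eq_top (hw : w.under (𝓞 F) ≠ ⊥)
    (hφ : IsArithFrobAt (𝓞 F) (φ : AbsGal F) w)
    (hN : IsOpen (N : Set (decompositionGroup (F := F) w))) :
    Subgroup.zpowers φ ⊔ inertiaGroup w ⊔ N = ⊤ := by
  obtain ⟨E, _, _, hE⟩ := exists_fixingSubgroup_mem_of_isOpen hN
  refine eq_top_iff.mpr fun g _ ↦ ?_
  obtain ⟨n, hn⟩ := exists_smul_sub_pow_smul_mem E hw hφ g.2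
  obtain ⟨u, hu, huE, h⟩ := exists_mem_fixingSubgroup_smul_sub_smul_mem E
    ((φ ^ n)⁻¹ * g).2 fun x ↦ by
      rw [← smul_mem_iff_of_mem_stabilizer (φ ^ n).2]
      simpa [smul_sub, mul_smul] using hn x
  have hI : (⟨u, hu⟩ : decompositionGroup w)⁻¹ * ((φ ^ n)⁻¹ * g) ∈ inertiaGroup w := fun x ↦ by
    change (u⁻¹ * ((φ ^ n)⁻¹ * g : decompositionGroup w) : AbsGal F) • x - x ∈ w
    rw [← smul_mem_iff_of_mem_stabilizer hu, smul_sub, mul_smul, smul_inv_smul, ← neg_mem_iff,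
      neg_sub]
    exact h x
  have hg : φ ^ n * ⟨u, hu⟩ * (⟨u, hu⟩⁻¹ * ((φ ^ n)⁻¹ * g)) = g := by group
  rw [← hg]
  refine mul_mem (mul_mem ?_ ?_) ?_
  · exact Subgroup.mem_sup_left (Subgroup.mem_sup_left (Subgroup.npow_mem_zpowers φ n))
  · exact Subgroup.mem_sup_right (hE _ huE)
  · exact Subgroup.mem_sup_left (Subgroup.mem_sup_right hI)

theorem exists_conj_mul_pow_inv_pow_mem (hw : w.under (𝓞 F) ≠ ⊥)
    (hφ : IsArithFrobAt (𝓞 F) (φ : AbsGal F) w)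
    (hN : IsOpen (N : Set (decompositionGroup (F := F) w)))
    {ℓ : ℕ} (hℓ : ℓ ≠ 1) (hℓw : (ℓ : 𝓞 (AlgebraicClosure F)) ∉ w)
    {τ : decompositionGroup (F := F) w} (hτ : τ ∈ inertiaGroup w) :
    ∃ n : ℕ, ¬ ℓ ∣ n ∧ (φ * τ * φ⁻¹ * (τ ^ Nat.card (𝓞 F ⧸ w.under (𝓞 F)))⁻¹) ^ n ∈ N := by
  obtain ⟨E, _, _, hE⟩ := exists_fixingSubgroup_mem_of_isOpen hN
  refine ⟨_, not_dvd_orderOf_restrictNormalHom E hw hφ hτ hℓ hℓw, hE _ ?_⟩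
  rw [← IntermediateField.restrictNormalHom_ker, MonoidHom.mem_ker]
  exact (map_pow (AlgEquiv.restrictNormalHom E) _ _).trans (pow_orderOf_eq_one _)

end Decomposition

section Cyclotomic

variable {ℓ : ℕ} [Fact ℓ.Prime]

theorem orderOf_quotient_mk_of_isPrimitiveRoot {R : Type*} [CommRing R] [IsDomain R] {P : Ideal R}
    (hℓ : (ℓ : R) ∉ P) {z : R} (hz : IsPrimitiveRoot z ℓ) :
    orderOf (Ideal.Quotient.mk P z) = ℓ := by
  refine orderOf_eq_prime (by rw [← map_pow, hz.pow_eq_one, map_one]) fun h ↦ hℓ ?_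
  have hsum := congrArg (Ideal.Quotient.mk P)
    (hz.geom_sum_eq_zero (Nat.Prime.one_lt (Fact.out : ℓ.Prime)))
  simp only [map_sum, map_pow, h, one_pow, Finset.sum_const, Finset.card_range, nsmul_one,
    map_zero] at hsum
  exact Ideal.Quotient.eq_zero_iff_mem.mp (by rwa [map_natCast])

theorem map_padicInt_eq_natCast {k : Type*} [CommRing k] [CharP k ℓ] (ψ : ℤ_[ℓ] →+* k)
    {x : ℤ_[ℓ]} {n : ℕ} (hx : PadicInt.toZModPow 1 x = n) : ψ x = n := by
  have hmem : x - n ∈ RingHom.ker (PadicInt.toZModPow (p := ℓ) 1) := by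
    rw [RingHom.mem_ker, map_sub, hx, map_natCast, sub_self]
  rw [PadicInt.ker_toZModPow, pow_one, Ideal.mem_span_singleton] at hmem
  obtain ⟨c, hc⟩ := hmem
  have h := congrArg ψ hc
  rwa [map_sub, map_mul, map_natCast, map_natCast, CharP.cast_eq_zero k ℓ, zero_mul,
    sub_eq_zero] at h

variable {F : Type*} [Field F] [CharZero F] {w : Ideal (𝓞 (AlgebraicClosure F))}

theorem toZModPow_cyclotomic_eq_natCast (hℓ : (ℓ : 𝓞 (AlgebraicClosure F)) ∉ w) {g : AbsGal F}
    {n : ℕ} (hg : ∀ x : 𝓞 (AlgebraicClosure F), g • x - x ^ n ∈ w) :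
    PadicInt.toZModPow 1 (cyclotomic F ℓ g : ℤ_[ℓ]) = n := by
  have hprime : ℓ.Prime := Fact.out
  have : NeZero (ℓ : AlgebraicClosure F) := ⟨Nat.cast_ne_zero.mpr hprime.ne_zero⟩
  have : NeZero (ℓ ^ 1) := ⟨pow_ne_zero 1 hprime.ne_zero⟩
  obtain ⟨ζ, hζ⟩ := HasEnoughRootsOfUnity.exists_primitiveRoot (AlgebraicClosure F) ℓ
  let z : 𝓞 (AlgebraicClosure F) := ⟨ζ, hζ.isIntegral hprime.pos⟩
  have hz : IsPrimitiveRoot z ℓ := IsPrimitiveRoot.of_map_of_injective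
    (f := algebraMap (𝓞 (AlgebraicClosure F)) (AlgebraicClosure F)) hζ RingOfIntegers.coe_injective
  set a := PadicInt.toZModPow 1 (cyclotomic F ℓ g : ℤ_[ℓ])
  have hgz : g • z = z ^ a.val := RingOfIntegers.coe_injective <|
    cyclotomicCharacter.spec ℓ (MulSemiringAction.toRingAut (AbsGal F) (AlgebraicClosure F) g) ζ
      (by rw [pow_one, hζ.pow_eq_one])
  have hpow : Ideal.Quotient.mk w z ^ a.val = Ideal.Quotient.mk w z ^ n := by
    rw [← map_pow, ← map_pow, ← hgz]
    exact Ideal.Quotient.eq.mpr (hg z)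
  have horder := orderOf_quotient_mk_of_isPrimitiveRoot hℓ hz
  have hfin := orderOf_pos_iff.mp (horder ▸ hprime.pos)
  rw [hfin.pow_eq_pow_iff_modEq, horder] at hpow
  rw [← ZMod.natCast_zmod_val a]
  exact (ZMod.natCast_eq_natCast_iff _ _ _).mpr (by simpa only [pow_one] using hpow)

theorem map_cyclotomic_eq_natCast (hℓ : (ℓ : 𝓞 (AlgebraicClosure F)) ∉ w) {g : AbsGal F} {n : ℕ}
    (hg : ∀ x : 𝓞 (AlgebraicClosure F), g • x - x ^ n ∈ w) {k : Type*} [CommRing k] [CharP k ℓ]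
    (ψ : ℤ_[ℓ] →+* k) : ψ (cyclotomic F ℓ g) = n :=
  map_padicInt_eq_natCast ψ (toZModPow_cyclotomic_eq_natCast hℓ hg)

end Cyclotomic

section Representations

open Matrix Polynomial

theorem exists_conj_eq_diagonal {n k : Type*} [Fintype n] [DecidableEq n] [Field k]
    {M : Matrix n n k} {d : n → k} (hd : Function.Injective d)
    (hroot : ∀ i, M.charpoly.IsRoot (d i)) :
    ∃ P : GL n k, P.val * M * P⁻¹.val = diagonal d := by
  have heigen (i : n) : Module.End.HasEigenvalue (toLin' M) (d i) := by
    rw [Module.End.hasEigenvalue_iff_isRoot_charpoly, charpoly_toLin']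
    exact hroot i
  choose v hv using fun i ↦ (heigen i).exists_hasEigenvector
  have hunit : IsUnit (of v)ᵀ := linearIndependent_cols_iff_isUnit.mp
    (Module.End.eigenvectors_linearIndependent' (toLin' M) d hd v hv)
  obtain ⟨Q, hQ⟩ := hunit
  have hMQ : M * Q.val = Q.val * diagonal d := by
    ext i j
    rw [hQ, mul_diagonal, mul_comm]
    exact congrFun (hv j).apply_eq_smul i
  exact ⟨Q⁻¹, by rw [inv_inv, mul_assoc, hMQ, ← mul_assoc, Units.inv_mul, one_mul]⟩

variable {Γ : Type*} [Group Γ]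

/-- The semisimplification of `σ` is `α ⊕ β`, in terms of characteristic polynomials. This makes
sense over any ring, so that it can be moved between a field, a ring of integers in it and the
residue field. -/
def HasSemisimplification {A : Type*} [CommRing A] (σ : Γ →* GL (Fin 2) A) (α β : Γ →* Aˣ) : Prop :=
  ∀ g, (σ g).val.charpoly = (X - C (α g : A)) * (X - C (β g : A))

namespace HasSemisimplification

variable {A B : Type*} [CommRing A] [CommRing B] {σ : Γ →* GL (Fin 2) A} {α β : Γ →* Aˣ}

theorem trace_eq (h : HasSemisimplification σ α β) (g : Γ) :
    (σ g).val 0 0 + (σ g).val 1 1 = α g + β g := by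
  nontriviality A
  have hfactor : (X - C (α g : A)) * (X - C (β g : A)) =
      X ^ 2 - C (α g + β g : A) * X + C (α g * β g : A) := by
    rw [map_add, map_mul]
    ring
  have hcoeff := congrArg (coeff · 1) ((h g).trans hfactor)
  refine neg_injective (?_ : -((σ g).val 0 0 + (σ g).val 1 1) = -(α g + β g : A))
  simpa [charpoly_fin_two, coeff_X, coeff_C, trace_fin_two] using hcoeff

theorem conj (h : HasSemisimplification σ α β) (P : GL (Fin 2) A) :
    HasSemisimplification ((MulAut.conj P).toMonoidHom.comp σ) α β := fun g ↦ by
  have hconj : ((MulAut.conj P).toMonoidHom.comp σ g).val = P.val * (σ g).val * P.val⁻¹ := by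
    rw [← coe_units_inv]
    rfl
  rw [hconj, charpoly_units_conj, h g]

theorem map (h : HasSemisimplification σ α β) (f : A →+* B) :
    HasSemisimplification ((GeneralLinearGroup.map f).comp σ)
      ((Units.map f.toMonoidHom).comp α) ((Units.map f.toMonoidHom).comp β) := fun g ↦ by
  have hmap := congrArg (Polynomial.map f) (h g)
  rw [← charpoly_map, Polynomial.map_mul, Polynomial.map_sub, Polynomial.map_sub, map_X, map_C,
    map_C] at hmap
  exact hmap

theorem of_map {f : A →+* B} (hf : Function.Injective f)
    (h : HasSemisimplification ((GeneralLinearGroup.map f).comp σ)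
      ((Units.map f.toMonoidHom).comp α) ((Units.map f.toMonoidHom).comp β)) :
    HasSemisimplification σ α β := fun g ↦ by
  refine Polynomial.map_injective f hf ?_
  rw [← charpoly_map, Polynomial.map_mul, Polynomial.map_sub, Polynomial.map_sub, map_X, map_C,
    map_C]
  exact h g

section Diagonal

variable [NoZeroDivisors A] {φ : Γ} (h : HasSemisimplification σ α β) (hαβ : (α φ : A) ≠ β φ)
  (hφ : (σ φ).val = diagonal ![(α φ : A), β φ])
include h hαβ hφ

theorem diag_eq (g : Γ) : (σ g).val 0 0 = α g ∧ (σ g).val 1 1 = β g := by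
  have htr := h.trace_eq g
  have htrφ := h.trace_eq (φ * g)
  rw [map_mul, Units.val_mul, hφ, diagonal_mul, diagonal_mul, map_mul, map_mul, Units.val_mul,
    Units.val_mul, cons_val_zero, cons_val_one, cons_val_fin_one] at htrφ
  have hα : ((α φ : A) - β φ) * ((σ g).val 0 0 - α g) = 0 := by
    linear_combination htrφ - (β φ : A) * htr
  have hα := sub_eq_zero.mp ((mul_eq_zero.mp hα).resolve_left (sub_ne_zero.mpr hαβ))
  exact ⟨hα, by linear_combination htr - hα⟩

theorem apply_zero_one_mul_apply_one_zero (a b : Γ) :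
    (σ a).val 0 1 * (σ b).val 1 0 = 0 := by
  have hdiag := fun g ↦ (h.diag_eq hαβ hφ g).1
  have hab := hdiag (a * b)
  rw [map_mul, Units.val_mul, mul_apply, Fin.sum_univ_two, hdiag, hdiag, map_mul,
    Units.val_mul] at hab
  linear_combination hab

end Diagonal

end HasSemisimplification

variable {k : Type*} [Field k] {σ : Γ →* GL (Fin 2) k} {α β : Γ →* kˣ} {ν : Γ → k}

theorem HasForm.hasSemisimplification (h : HasForm σ α β ν) : HasSemisimplification σ α β := by
  obtain ⟨P, hP⟩ := h
  intro g
  rw [← charpoly_units_conj P, ← coe_units_inv, ← Units.val_mul, ← Units.val_mul, hP,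
    charpoly_fin_two, trace_fin_two_of, det_fin_two_of, mul_zero, sub_zero, map_add, map_mul]
  ring

theorem HasForm.of_conj {P : GL (Fin 2) k}
    (h : HasForm ((MulAut.conj P).toMonoidHom.comp σ) α β ν) : HasForm σ α β ν := by
  obtain ⟨Q, hQ⟩ := h
  refine ⟨Q * P, fun g ↦ ?_⟩
  rw [← hQ g, MonoidHom.comp_apply, MulEquiv.coe_toMonoidHom, MulAut.conj_apply]
  group

theorem hasForm_of_lowerTriangular (h : ∀ g, (σ g).val = !![(α g : k), 0; ν g, (β g : k)]) :
    HasForm σ β α ν := by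
  have hswap : Matrix.swap k (0 : Fin 2) 1 = !![0, 1; 1, 0] := by
    ext i j
    fin_cases i <;> fin_cases j <;> simp [Matrix.swap, PEquiv.toMatrix_apply]
  refine ⟨GeneralLinearGroup.swap k 0 1, fun g ↦ ?_⟩
  change Matrix.swap k 0 1 * (σ g).val * Matrix.swap k 0 1 = _
  simp [hswap, h]

theorem exists_hasForm_or_of_hasSemisimplification (hσ : HasSemisimplification σ α β) {φ : Γ}
    (hαβ : (α φ : k) ≠ β φ) : ∃ ν : Γ → k, ν φ = 0 ∧ (HasForm σ α β ν ∨ HasForm σ β α ν) := by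
  have hinj : Function.Injective ![(α φ : k), β φ] := by
    simpa [Fin.forall_fin_two, Function.Injective, hαβ] using hαβ.symm
  have hroot (i : Fin 2) : (σ φ).val.charpoly.IsRoot (![(α φ : k), β φ] i) := by
    fin_cases i <;> simp [hσ φ]
  obtain ⟨P, hP⟩ := exists_conj_eq_diagonal hinj hroot
  set σ' := (MulAut.conj P).toMonoidHom.comp σ
  have hφ : (σ' φ).val = diagonal ![(α φ : k), β φ] := hP
  have hss := hσ.conj P
  have hdiag := hss.diag_eq hαβ hφ
  by_cases hlower : ∀ g, (σ' g).val 1 0 = 0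
  · refine ⟨fun g ↦ (σ' g).val 0 1, by simp [hφ], .inl <| .of_conj (P := P) ⟨1, fun g ↦ ?_⟩⟩
    rw [one_mul, inv_one, mul_one, eta_fin_two (σ' g).val, (hdiag g).1, (hdiag g).2, hlower]
  · push Not at hlower
    obtain ⟨b, hb⟩ := hlower
    refine ⟨fun g ↦ (σ' g).val 1 0, by simp [hφ], .inr <| .of_conj (P := P) <|
      hasForm_of_lowerTriangular fun g ↦ ?_⟩
    have hupper : (σ' g).val 0 1 = 0 :=
      (mul_eq_zero.mp (hss.apply_zero_one_mul_apply_one_zero hαβ hφ g b)).resolve_right hb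
    exact (eta_fin_two _).trans (by rw [(hdiag g).1, (hdiag g).2, hupper])

namespace HasForm

variable (h : HasForm σ α β ν)
include h

theorem apply_mul (a b : Γ) : ν (a * b) = α a * ν b + ν a * β b := by
  obtain ⟨P, hP⟩ := h
  have hab := hP (a * b)
  rw [← MulAut.conj_apply, map_mul, map_mul, Units.val_mul, MulAut.conj_apply, MulAut.conj_apply,
    hP, hP, mul_fin_two] at hab
  exact (congrFun₂ hab 0 1).symm

theorem eq_of_mem_ker {u : Γ} (hu : u ∈ σ.ker) : ν u = 0 ∧ α u = 1 ∧ β u = 1 := by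
  obtain ⟨P, hP⟩ := h
  have hone := hP u
  rw [hu, mul_one, mul_inv_cancel, Units.val_one, one_fin_two] at hone
  exact ⟨(congrFun₂ hone 0 1).symm, Units.ext (congrFun₂ hone 0 0).symm,
    Units.ext (congrFun₂ hone 1 1).symm⟩

theorem apply_one : ν 1 = 0 := (h.eq_of_mem_ker (one_mem _)).1

theorem apply_inv_eq_zero {g : Γ} (hg : ν g = 0) : ν g⁻¹ = 0 := by
  have hmul := h.apply_mul g g⁻¹
  rw [mul_inv_cancel, h.apply_one, hg, zero_mul, add_zero] at hmul
  exact (mul_eq_zero.mp hmul.symm).resolve_left (α g).ne_zero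

theorem apply_conj_mul {g : Γ} (hg : ν g = 0) (τ : Γ) :
    ν (g * τ * g⁻¹) * β g = α g * ν τ := by
  have hmul := h.apply_mul (g * τ * g⁻¹) g
  rw [inv_mul_cancel_right, h.apply_mul, hg, mul_zero, zero_mul, zero_add, add_zero] at hmul
  exact hmul.symm

theorem swap (hν : ∀ g, ν g = 0) : HasForm σ β α ν := by
  obtain ⟨P, hP⟩ := h
  refine .of_conj (P := P) (hasForm_of_lowerTriangular fun g ↦ ?_)
  rw [hν g, ← hν g]
  exact (hP g).trans (by rw [hν g])

theorem sub_coboundary (t : k) : HasForm σ α β fun g ↦ ν g - t * (α g - β g) := by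
  obtain ⟨P, hP⟩ := h
  refine .of_conj (P := P) ⟨GeneralLinearGroup.upperRightHom t, fun g ↦ ?_⟩
  have hg : ((MulAut.conj P).toMonoidHom.comp σ g).val = !![(α g : k), ν g; 0, (β g : k)] := hP g
  rw [Units.val_mul, Units.val_mul, hg, ← AddChar.map_neg_eq_inv,
    GeneralLinearGroup.upperRightHom_apply, GeneralLinearGroup.upperRightHom_apply, mul_fin_two,
    mul_fin_two]
  congr! 3 <;> ring_nf

theorem eq_zero {φ : Γ} {I : Subgroup Γ} (hgen : Subgroup.zpowers φ ⊔ I ⊔ σ.ker = ⊤)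
    (hφ : ν φ = 0) (hI : ∀ τ ∈ I, ν τ = 0) (g : Γ) : ν g = 0 := by
  let Z : Subgroup Γ :=
    { carrier := {g | ν g = 0}
      one_mem' := h.apply_one
      mul_mem' := fun {a b} ha hb ↦ by
        rw [Set.mem_ofPred_eq, h.apply_mul, ha, hb, mul_zero, zero_mul, add_zero]
      inv_mem' := h.apply_inv_eq_zero }
  have hZ : ⊤ ≤ Z := hgen ▸ sup_le (sup_le (Subgroup.zpowers_le.mpr hφ) hI) fun u hu ↦
    (h.eq_of_mem_ker hu).1
  exact hZ (Subgroup.mem_top g)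

theorem splitsOn_top {φ : Γ} {I : Subgroup Γ} (hgen : Subgroup.zpowers φ ⊔ I ⊔ σ.ker = ⊤)
    (hαβ : (α φ : k) ≠ β φ) (hI : ∀ τ ∈ I, α τ = β τ) (hν : SplitsOn I α β ν) :
    SplitsOn ⊤ α β ν := by
  obtain ⟨s, hs⟩ := hν
  refine ⟨ν φ / (α φ - β φ), fun g _ ↦ sub_eq_zero.mp ?_⟩
  refine (h.sub_coboundary (ν φ / (α φ - β φ))).eq_zero hgen ?_ (fun τ hτ ↦ ?_) g
  · rw [div_mul_cancel₀ _ (sub_ne_zero.mpr hαβ), sub_self]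
  · rw [hs τ hτ, hI τ hτ, sub_self, mul_zero, mul_zero, sub_self]

theorem exists_monoidHom {I : Subgroup Γ} (hI : ∀ τ ∈ I, α τ = β τ) :
    ∃ c : I →* Multiplicative k, ∀ τ : I, ν τ = β τ * (c τ).toAdd := by
  have hβ (τ : Γ) : (β τ : k) ≠ 0 := (β τ).ne_zero
  refine ⟨.mk' (fun τ ↦ .ofAdd (ν τ / β τ)) fun a b ↦ congrArg Multiplicative.ofAdd ?_,
    fun τ ↦ (mul_div_cancel₀ _ (hβ τ)).symm⟩
  have ha := hβ a
  have hb := hβ b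
  change ν (a * b) / β (a * b) = ν a / β a + ν b / β b
  rw [h.apply_mul, hI a a.2, map_mul, Units.val_mul]
  field_simp
  ring

theorem apply_conj_of_pow_mem_ker {I : Subgroup Γ} [I.Normal] (hI : ∀ τ ∈ I, α τ = β τ)
    (φ : Γ) {τ : Γ} (hτ : τ ∈ I) {q n : ℕ} (hn : (n : k) ≠ 0)
    (hker : (φ * τ * φ⁻¹ * (τ ^ q)⁻¹) ^ n ∈ σ.ker) : ν (φ * τ * φ⁻¹) = q * ν τ := by
  obtain ⟨c, hc⟩ := h.exists_monoidHom hI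
  let t : I := ⟨τ, hτ⟩
  let s : I := ⟨φ * τ * φ⁻¹, Subgroup.Normal.conj_mem inferInstance τ hτ φ⟩
  have hω : (c (s * (t ^ q)⁻¹)).toAdd = 0 := by
    have hzero := hc ((s * (t ^ q)⁻¹) ^ n)
    rw [map_pow, toAdd_pow, nsmul_eq_mul] at hzero
    have hpow := mul_eq_zero.mp (hzero.symm.trans (h.eq_of_mem_ker hker).1)
    exact (mul_eq_zero.mp (hpow.resolve_left (Units.ne_zero _))).resolve_left hn
  have hst : (c s).toAdd = q * (c t).toAdd := by
    rwa [map_mul, map_inv, map_pow, toAdd_mul, toAdd_inv, toAdd_pow, nsmul_eq_mul,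
      ← sub_eq_add_neg, sub_eq_zero] at hω
  have hβ : β (φ * τ * φ⁻¹) = β τ := by rw [map_mul, map_mul, map_inv, mul_inv_cancel_comm]
  rw [hc s, hc t, hst, hβ]
  ring

theorem eq_zero_of_mem {I : Subgroup Γ} [I.Normal] (hI : ∀ τ ∈ I, α τ = β τ) {φ : Γ}
    (hφ : ν φ = 0) {q : ℕ} (hαβ : (α φ : k) ≠ q * β φ) {τ : Γ} (hτ : τ ∈ I) {n : ℕ}
    (hn : (n : k) ≠ 0) (hker : (φ * τ * φ⁻¹ * (τ ^ q)⁻¹) ^ n ∈ σ.ker) : ν τ = 0 := by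
  have hconj := h.apply_conj_mul hφ τ
  rw [h.apply_conj_of_pow_mem_ker hI φ hτ hn hker] at hconj
  have hmul : (α φ - q * β φ : k) * ν τ = 0 := by linear_combination -hconj
  exact (mul_eq_zero.mp hmul).resolve_left (sub_ne_zero.mpr hαβ)

end HasForm

theorem exists_hasForm_of_tame (hσ : HasSemisimplification σ α β) {φ : Γ} {I : Subgroup Γ}
    [I.Normal] (hgen : Subgroup.zpowers φ ⊔ I ⊔ σ.ker = ⊤) (hI : ∀ τ ∈ I, α τ = β τ) {q : ℕ}
    (hφ : (α φ : k) = q * β φ) (hq : (q : k) ^ 2 ≠ 1)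
    (htame : ∀ τ ∈ I, ∃ n : ℕ, (n : k) ≠ 0 ∧ (φ * τ * φ⁻¹ * (τ ^ q)⁻¹) ^ n ∈ σ.ker) :
    ∃ ν : Γ → k, HasForm σ α β ν := by
  have hq1 : (q : k) ≠ 1 := fun h ↦ hq (by rw [h, one_pow])
  have hαβ : (α φ : k) ≠ β φ := by
    rw [hφ]
    exact (mul_eq_right₀ (β φ).ne_zero).not.mpr hq1
  have hβα : (β φ : k) ≠ q * α φ := by
    rw [hφ, ← mul_assoc, ← sq]
    exact (right_eq_mul₀ (β φ).ne_zero).not.mpr hq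
  obtain ⟨ν, hνφ, h | h⟩ := exists_hasForm_or_of_hasSemisimplification hσ hαβ
  · exact ⟨ν, h⟩
  · refine ⟨ν, h.swap (h.eq_zero hgen hνφ fun τ hτ ↦ ?_)⟩
    obtain ⟨n, hn, hker⟩ := htame τ hτ
    exact h.eq_zero_of_mem (fun τ hτ ↦ (hI τ hτ).symm) hνφ hβα hτ hn hker

end Representations

section IntegralClosure

open Matrix

variable {R A Γ : Type*} [CommRing R] [CommRing A] [Algebra R A] [Group Γ]
  {ρ₀ : Γ →* GL (Fin 2) R} {α β : Γ →* Aˣ}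

theorem HasSemisimplification.exists_integral_character
    (h : HasSemisimplification ((GeneralLinearGroup.map (algebraMap R A)).comp ρ₀) α β) :
    ∃ β₀ : Γ →* (integralClosure R A)ˣ, ∀ g, ((β₀ g : integralClosure R A) : A) = β g := by
  have hβ (g : Γ) : IsIntegral R (β g : A) := by
    refine ⟨(ρ₀ g).val.charpoly, charpoly_monic _, ?_⟩
    rw [← Polynomial.eval_map, ← charpoly_map]
    refine (congrArg (Polynomial.eval _) (h g)).trans ?_
    rw [Polynomial.eval_mul, Polynomial.eval_sub, Polynomial.eval_sub, Polynomial.eval_X,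
      Polynomial.eval_C, Polynomial.eval_C, sub_self, mul_zero]
  let β₀ : Γ →* integralClosure R A := ((Units.coeHom A).comp β).codRestrict _ hβ
  exact ⟨β₀.toHomUnits, fun _ ↦ rfl⟩

theorem HasSemisimplification.of_integralClosure
    (h : HasSemisimplification ((GeneralLinearGroup.map (algebraMap R A)).comp ρ₀) α β)
    {α₀ β₀ : Γ →* (integralClosure R A)ˣ} (hα : ∀ g, ((α₀ g : integralClosure R A) : A) = α g)
    (hβ : ∀ g, ((β₀ g : integralClosure R A) : A) = β g) :
    HasSemisimplification
      ((GeneralLinearGroup.map (algebraMap R (integralClosure R A))).comp ρ₀) α₀ β₀ := by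
  refine .of_map (f := algebraMap (integralClosure R A) A) Subtype.val_injective ?_
  obtain rfl : (Units.map (algebraMap (integralClosure R A) A).toMonoidHom).comp α₀ = α :=
    MonoidHom.ext fun g ↦ Units.ext (hα g)
  obtain rfl : (Units.map (algebraMap (integralClosure R A) A).toMonoidHom).comp β₀ = β :=
    MonoidHom.ext fun g ↦ Units.ext (hβ g)
  exact h

end IntegralClosure

section Coefficients

open Matrix

variable {K : Type*} [Field K] [NumberField K] {l : HeightOneSpectrum (𝓞 K)}

theorem residueBar_algebraMap_eq_zero_iff (x : 𝓞 K) :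
    algebraMap (Residue l) (ResidueBar l) (IsLocalRing.residue (Integers l)
      (algebraMap (𝓞 K) (Integers l) x)) = 0 ↔ x ∈ l.asIdeal := by
  rw [map_eq_zero, IsLocalRing.residue_eq_zero_iff,
    ← HeightOneSpectrum.valuation_lt_one_iff_mem (K := K),
    ← HeightOneSpectrum.valuedAdicCompletion_eq_valuation']
  exact Valuation.mem_maximalIdeal_iff (v := (Valued.v : Valuation (Compl l) _))

theorem charP_residueBar {ℓ : ℕ} [Fact ℓ.Prime] (hℓ : (ℓ : 𝓞 K) ∈ l.asIdeal) :
    CharP (ResidueBar l) ℓ :=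
  (CharP.charP_iff_prime_eq_zero Fact.out).mpr <| by
    simpa only [map_natCast] using (residueBar_algebraMap_eq_zero_iff (ℓ : 𝓞 K)).mpr hℓ

theorem natCast_residueBar_sq_ne_one {q : ℕ} (hq : (q : 𝓞 K) ^ 2 - 1 ∉ l.asIdeal) :
    (q : ResidueBar l) ^ 2 ≠ 1 := fun h ↦ hq <| by
  rw [← residueBar_algebraMap_eq_zero_iff]
  simp only [map_sub, map_pow, map_natCast, map_one, h, sub_self]

variable {Γ G : Type*} [Group Γ] [Group G]

theorem IsIntegralModel.hasSemisimplification {ρ : Γ →* GL (Fin 2) (Compl l)}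
    {ρ₀ : Γ →* GL (Fin 2) (Integers l)} (hρ₀ : IsIntegralModel ρ ρ₀) {α β : Γ →* (ComplBar l)ˣ}
    (h : HasSemisimplification
      ((GeneralLinearGroup.map (algebraMap (Compl l) (ComplBar l))).comp ρ) α β) :
    HasSemisimplification
      ((GeneralLinearGroup.map (algebraMap (Integers l) (ComplBar l))).comp ρ₀) α β := by
  obtain ⟨Q, hQ⟩ := hρ₀
  convert h.conj (GeneralLinearGroup.map (algebraMap (Compl l) (ComplBar l)) Q) using 1
  ext1 g
  have hg := congrArg (GeneralLinearGroup.map (algebraMap (Compl l) (ComplBar l))) (hQ g)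
  rw [map_mul, map_mul, map_inv] at hg
  exact hg

theorem IsResidual.comp [TopologicalSpace Γ] [TopologicalSpace G] {ρ : G →* GL (Fin 2) (Compl l)}
    {ρbar : G →* GL (Fin 2) (Residue l)} (h : IsResidual ρ ρbar) {f : Γ →* G}
    (hf : Continuous f) : IsResidual (ρ.comp f) (ρbar.comp f) := by
  obtain ⟨hopen, ρ₀, ⟨Q, hQ⟩, hchar⟩ := h
  exact ⟨hopen.preimage hf, ρ₀.comp f, ⟨Q, fun g ↦ hQ (f g)⟩, fun g ↦ hchar (f g)⟩

theorem IsReductionMap.hasSemisimplification {red : IntegersBar l →+* ResidueBar l}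
    (hred : IsReductionMap l red) {ρ₀ : Γ →* GL (Fin 2) (Integers l)}
    {ρbar : Γ →* GL (Fin 2) (Residue l)}
    (hchar : ∀ g, (ρbar g).val.charpoly =
      (GeneralLinearGroup.map (IsLocalRing.residue (Integers l)) (ρ₀ g)).val.charpoly)
    {α β : Γ →* (IntegersBar l)ˣ}
    (h : HasSemisimplification
      ((GeneralLinearGroup.map (algebraMap (Integers l) (IntegersBar l))).comp ρ₀) α β) :
    HasSemisimplification
      ((GeneralLinearGroup.map (algebraMap (Residue l) (ResidueBar l))).comp ρbar)
      ((Units.map red.toMonoidHom).comp α) ((Units.map red.toMonoidHom).comp β) := fun g ↦ by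
  have hcomm : red.comp (algebraMap (Integers l) (IntegersBar l)) =
      (algebraMap (Residue l) (ResidueBar l)).comp (IsLocalRing.residue (Integers l)) :=
    RingHom.ext hred
  calc ((ρbar g).val.map (algebraMap (Residue l) (ResidueBar l))).charpoly
      = ((ρ₀ g).val.charpoly.map (IsLocalRing.residue (Integers l))).map
          (algebraMap (Residue l) (ResidueBar l)) := by
        rw [charpoly_map, hchar, ← charpoly_map (ρ₀ g).val]
        rfl
    _ = (((ρ₀ g).val.map (algebraMap (Integers l) (IntegersBar l))).map red).charpoly := by
        rw [charpoly_map, charpoly_map, Polynomial.map_map, Polynomial.map_map, hcomm]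
    _ = _ := h.map red g

theorem IsResidual.exists_hasSemisimplification [TopologicalSpace Γ]
    {ρ : Γ →* GL (Fin 2) (Compl l)} {ρbar : Γ →* GL (Fin 2) (Residue l)}
    (hρbar : IsResidual ρ ρbar) {ε : Γ →* (Integers l)ˣ} {χ : Γ →* (ComplBar l)ˣ}
    (h : HasSemisimplification
      ((GeneralLinearGroup.map (algebraMap (Compl l) (ComplBar l))).comp ρ)
      ((Units.map (algebraMap (Integers l) (ComplBar l)).toMonoidHom).comp ε * χ) χ)
    {red : IntegersBar l →+* ResidueBar l} (hred : IsReductionMap l red) :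
    ∃ χ₀ : Γ →* (IntegersBar l)ˣ, (∀ g, ((χ₀ g : IntegersBar l) : ComplBar l) = χ g) ∧
      HasSemisimplification
        ((GeneralLinearGroup.map (algebraMap (Residue l) (ResidueBar l))).comp ρbar)
        ((Units.map ((algebraMap (Residue l) (ResidueBar l)).comp
          (IsLocalRing.residue (Integers l))).toMonoidHom).comp ε *
            (Units.map red.toMonoidHom).comp χ₀)
        ((Units.map red.toMonoidHom).comp χ₀) := by
  obtain ⟨-, ρ₀, hρ₀, hchar⟩ := hρbar
  have hss := hρ₀.hasSemisimplification h
  obtain ⟨χ₀, hχ₀⟩ := hss.exists_integral_character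
  let ε₀ := (Units.map (algebraMap (Integers l) (IntegersBar l)).toMonoidHom).comp ε
  have hε₀ (g : Γ) : (((ε₀ * χ₀) g : IntegersBar l) : ComplBar l) =
      algebraMap (Integers l) (ComplBar l) (ε g) * χ g := by
    rw [← hχ₀ g]
    rfl
  have hbar := hred.hasSemisimplification hchar (hss.of_integralClosure hε₀ hχ₀)
  refine ⟨χ₀, hχ₀, ?_⟩
  convert hbar using 1
  ext g
  exact (congrArg (· * red (χ₀ g)) (hred (ε g)).symm).trans (map_mul red _ _).symm

end Coefficients

section Local

open Matrix

variable {F : Type*} [Field F] {ℓ : ℕ} [Fact ℓ.Prime]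

/-- The restriction of `ρ` to the decomposition group at `w`, with coefficients extended
along `f`. -/
noncomputable def localRep {A B : Type*} [CommRing A] [CommRing B]
    (w : Ideal (𝓞 (AlgebraicClosure F))) (f : A →+* B) (ρ : AbsGal F →* GL (Fin 2) A) :
    decompositionGroup w →* GL (Fin 2) B :=
  (GeneralLinearGroup.map f).comp (ρ.comp (decompositionGroup w).subtype)

/-- The restriction of the `ℓ`-adic cyclotomic character to the decomposition group at `w`, with
coefficients extended along `ψ`. -/
noncomputable def localCyclotomic {A : Type*} [CommRing A] (w : Ideal (𝓞 (AlgebraicClosure F)))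
    (ψ : ℤ_[ℓ] →+* A) : decompositionGroup w →* Aˣ :=
  (Units.map ψ.toMonoidHom).comp ((cyclotomic F ℓ).comp (decompositionGroup w).subtype)

variable {w : Ideal (𝓞 (AlgebraicClosure F))}

theorem isOpen_ker_localRep {A B : Type*} [CommRing A] [CommRing B] (f : A →+* B)
    {ρ : AbsGal F →* GL (Fin 2) A} (hρ : IsOpen (ρ.ker : Set (AbsGal F))) :
    IsOpen ((localRep w f ρ).ker : Set (decompositionGroup w)) :=
  Subgroup.isOpen_mono (H₁ := ρ.ker.comap (decompositionGroup w).subtype)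
    (fun _ hg ↦ (congrArg (GeneralLinearGroup.map f) hg).trans (map_one _))
    (hρ.preimage continuous_subtype_val)

variable {k : Type*} [Field k] [CharP k ℓ] {ψ : ℤ_[ℓ] →+* k}

theorem localCyclotomic_eq_one_of_mem_inertiaGroup [CharZero F]
    (hℓ : (ℓ : 𝓞 (AlgebraicClosure F)) ∉ w) {τ : decompositionGroup w}
    (hτ : τ ∈ inertiaGroup w) : localCyclotomic w ψ τ = 1 :=
  Units.ext <| (map_cyclotomic_eq_natCast (n := 1) hℓ (fun x ↦ by rw [pow_one]; exact hτ x)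
    ψ).trans Nat.cast_one

theorem localCyclotomic_mul_eq_of_mem_inertiaGroup [CharZero F]
    (hℓ : (ℓ : 𝓞 (AlgebraicClosure F)) ∉ w) (χ : decompositionGroup w →* kˣ)
    {τ : decompositionGroup w} (hτ : τ ∈ inertiaGroup w) :
    (localCyclotomic w ψ * χ) τ = χ τ := by
  rw [MonoidHom.mul_apply, localCyclotomic_eq_one_of_mem_inertiaGroup hℓ hτ, one_mul]

theorem localCyclotomic_mul_frobenius [CharZero F] (hℓ : (ℓ : 𝓞 (AlgebraicClosure F)) ∉ w)
    (χ : decompositionGroup w →* kˣ) {φ : decompositionGroup w}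
    (hφ : IsArithFrobAt (𝓞 F) (φ : AbsGal F) w) :
    ((localCyclotomic w ψ * χ) φ : k) = Nat.card (𝓞 F ⧸ w.under (𝓞 F)) * χ φ :=
  congrArg (· * (χ φ : k)) (map_cyclotomic_eq_natCast hℓ hφ ψ)

variable [NumberField F] [w.IsPrime] {σ : decompositionGroup w →* GL (Fin 2) k}
  {χ : decompositionGroup w →* kˣ}

theorem exists_hasForm_localCyclotomic_mul (hw : w.under (𝓞 F) ≠ ⊥)
    (hℓ : (ℓ : 𝓞 (AlgebraicClosure F)) ∉ w)
    (hq : (Nat.card (𝓞 F ⧸ w.under (𝓞 F)) : k) ^ 2 ≠ 1)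
    (hopen : IsOpen (σ.ker : Set (decompositionGroup w)))
    (hσ : HasSemisimplification σ (localCyclotomic w ψ * χ) χ) :
    ∃ ν, HasForm σ (localCyclotomic w ψ * χ) χ ν := by
  obtain ⟨φ, hφ⟩ := exists_frobenius_mem_decompositionGroup hw
  refine exists_hasForm_of_tame hσ (zpowers_sup_inertiaGroup_sup_eq_top hw hφ hopen)
    (fun τ ↦ localCyclotomic_mul_eq_of_mem_inertiaGroup hℓ χ)
    (localCyclotomic_mul_frobenius hℓ χ hφ) hq fun τ hτ ↦ ?_
  obtain ⟨n, hn, hker⟩ := exists_conj_mul_pow_inv_pow_mem hw hφ hopen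
    (Fact.out : ℓ.Prime).ne_one hℓ hτ
  exact ⟨n, (CharP.cast_eq_zero_iff k ℓ n).not.mpr hn, hker⟩

theorem splitsOn_top_of_splitsOn_inertiaGroup (hw : w.under (𝓞 F) ≠ ⊥)
    (hℓ : (ℓ : 𝓞 (AlgebraicClosure F)) ∉ w)
    (hq : (Nat.card (𝓞 F ⧸ w.under (𝓞 F)) : k) ≠ 1)
    (hopen : IsOpen (σ.ker : Set (decompositionGroup w))) {ν : decompositionGroup w → k}
    (h : HasForm σ (localCyclotomic w ψ * χ) χ ν)
    (hν : SplitsOn (inertiaGroup w) (localCyclotomic w ψ * χ) χ ν) :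
    SplitsOn ⊤ (localCyclotomic w ψ * χ) χ ν := by
  obtain ⟨φ, hφ⟩ := exists_frobenius_mem_decompositionGroup hw
  refine h.splitsOn_top (zpowers_sup_inertiaGroup_sup_eq_top hw hφ hopen) ?_
    (fun τ ↦ localCyclotomic_mul_eq_of_mem_inertiaGroup hℓ χ) hν
  rw [localCyclotomic_mul_frobenius hℓ χ hφ]
  exact (mul_eq_right₀ (χ φ).ne_zero).not.mpr hq

end Local

end SpecialReduction

open SpecialReduction in
theorem lemma3p3_general {F K : Type*} [Field F] [NumberField F] [Field K] [NumberField K]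
    (v : HeightOneSpectrum (𝓞 F)) (w : Ideal (𝓞 (AlgebraicClosure F))) [w.IsPrime]
    (hw : w.under (𝓞 F) = v.asIdeal) (l : HeightOneSpectrum (𝓞 K)) (ℓ : ℕ) [Fact ℓ.Prime]
    (hℓ : (ℓ : 𝓞 K) ∈ l.asIdeal) (hvℓ : (ℓ : 𝓞 F) ∉ v.asIdeal)
    (hq : (Nat.card (𝓞 F ⧸ v.asIdeal) : 𝓞 K) ^ 2 - 1 ∉ l.asIdeal)
    (j : ℤ_[ℓ] →+* Integers l) (ρ : AbsGal F →* GL (Fin 2) (Compl l))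
    (ρbar : AbsGal F →* GL (Fin 2) (Residue l)) (hρbar : IsResidual ρ ρbar)
    (χ : decompositionGroup w →* (ComplBar l)ˣ)
    (hχ : ∃ b, HasForm (localRep w (algebraMap (Compl l) (ComplBar l)) ρ)
      (localCyclotomic w ((algebraMap (Integers l) (ComplBar l)).comp j) * χ) χ b)
    (red : IntegersBar l →+* ResidueBar l) (hred : IsReductionMap l red) :
    ∃ χ₀ : decompositionGroup w →* (IntegersBar l)ˣ,
      (∀ g, ((χ₀ g : IntegersBar l) : ComplBar l) = χ g) ∧
      let χbar := (Units.map red.toMonoidHom).comp χ₀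
      let εbar := localCyclotomic w ((algebraMap (Residue l) (ResidueBar l)).comp
        ((IsLocalRing.residue (Integers l)).comp j))
      let ρbar_v := localRep w (algebraMap (Residue l) (ResidueBar l)) ρbar
      (∃ ν, HasForm ρbar_v (εbar * χbar) χbar ν) ∧
      ∀ ν, HasForm ρbar_v (εbar * χbar) χbar ν →
        SplitsOn (inertiaGroup w) (εbar * χbar) χbar ν → SplitsOn ⊤ (εbar * χbar) χbar ν := by
  obtain ⟨b, hform⟩ := hχ
  have hwbot : w.under (𝓞 F) ≠ ⊥ := hw ▸ v.ne_bot
  have hℓw : (ℓ : 𝓞 (AlgebraicClosure F)) ∉ w := fun h ↦ hvℓ <| by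
    rwa [← hw, Ideal.mem_comap, map_natCast]
  have hq2 := natCast_residueBar_sq_ne_one hq
  rw [← hw] at hq2
  have hq1 : (Nat.card (𝓞 F ⧸ w.under (𝓞 F)) : ResidueBar l) ≠ 1 := fun h ↦
    hq2 (by rw [h, one_pow])
  have := charP_residueBar hℓ
  have hres := hρbar.comp (f := (decompositionGroup w).subtype) continuous_subtype_val
  have hopen := isOpen_ker_localRep (w := w) (algebraMap (Residue l) (ResidueBar l)) hρbar.1
  obtain ⟨χ₀, hχ₀, hss⟩ := hres.exists_hasSemisimplification
    (ε := localCyclotomic w j) hform.hasSemisimplification hred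
  exact ⟨χ₀, hχ₀, exists_hasForm_localCyclotomic_mul hwbot hℓw hq2 hopen hss,
    fun ν ↦ splitsOn_top_of_splitsOn_inertiaGroup hwbot hℓw hq1 hopen⟩

open SpecialReduction in
theorem lemma3p3 {F K : Type*} [Field F] [NumberField F] [Field K] [NumberField K]
    -- a finite place `v` of `F`, and a decomposition group at `v` given by a prime `w` over `v`
    (v : HeightOneSpectrum (𝓞 F)) (w : Ideal (𝓞 (AlgebraicClosure F))) [w.IsPrime]
    (hw : w.comap (algebraMap (𝓞 F) (𝓞 (AlgebraicClosure F))) = v.asIdeal)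
    -- a prime `l` of `K` over `ℓ`, where `v` does not divide `ℓ`
    (l : HeightOneSpectrum (𝓞 K)) (ℓ : ℕ) [Fact ℓ.Prime]
    (hℓ : (ℓ : 𝓞 K) ∈ l.asIdeal) (hvℓ : (ℓ : 𝓞 F) ∉ v.asIdeal)
    (hq : (Nat.card (𝓞 F ⧸ v.asIdeal) : 𝓞 K) ^ 2 - 1 ∉ l.asIdeal)
    -- the (unique) ring homomorphism from the `ℓ`-adic integers to the integers of `K_l`
    (j : ℤ_[ℓ] →+* Integers l)
    (ρ : AbsGal F →* GL (Fin 2) (Compl l)) (hρ : Continuous ρ)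
    (ρbar : AbsGal F →* GL (Fin 2) (Residue l)) (hρbar : IsResidual ρ ρbar)
    -- over the algebraic closure of `K_l`, the restriction of `ρ` to `G_v` is a nonsplit extension
    -- of `χ` by `ε χ`
    (χ : decompositionGroup w →* (ComplBar l)ˣ)
    (hχ : ∃ b : decompositionGroup w → ComplBar l,
      let εχ := ((Units.map ((algebraMap (Integers l) (ComplBar l)).comp j).toMonoidHom).comp
        ((cyclotomic F ℓ).comp (decompositionGroup w).subtype)) * χ
      HasForm ((Matrix.GeneralLinearGroup.map (algebraMap (Compl l) (ComplBar l))).comp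
        (ρ.comp (decompositionGroup w).subtype)) εχ χ b ∧ ¬ SplitsOn ⊤ εχ χ b)
    (red : IntegersBar l →+* ResidueBar l) (hred : IsReductionMap l red) :
    -- `χ` has integral values, hence a reduction `χbar`
    ∃ χ₀ : decompositionGroup w →* (IntegersBar l)ˣ,
      (∀ g, ((χ₀ g : IntegersBar l) : ComplBar l) = χ g) ∧
      let χbar : decompositionGroup w →* (ResidueBar l)ˣ := (Units.map red.toMonoidHom).comp χ₀
      let εbar : decompositionGroup w →* (ResidueBar l)ˣ :=
        (Units.map ((algebraMap (Residue l) (ResidueBar l)).comp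
          ((IsLocalRing.residue (Integers l)).comp j)).toMonoidHom).comp
          ((cyclotomic F ℓ).comp (decompositionGroup w).subtype)
      let ρbar_v : decompositionGroup w →* GL (Fin 2) (ResidueBar l) :=
        (Matrix.GeneralLinearGroup.map (algebraMap (Residue l) (ResidueBar l))).comp
          (ρbar.comp (decompositionGroup w).subtype)
      (∃ ν : decompositionGroup w → ResidueBar l, HasForm ρbar_v (εbar * χbar) χbar ν) ∧
      -- in every such form, the class of `ν` is ramified unless it vanishes
      ∀ ν : decompositionGroup w → ResidueBar l, HasForm ρbar_v (εbar * χbar) χbar ν →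
        ¬ SplitsOn ⊤ (εbar * χbar) χbar ν →
        ¬ SplitsOn (inertiaGroup w) (εbar * χbar) χbar ν := by
  obtain ⟨χ₀, hχ₀, hform, hsplit⟩ := lemma3p3_general v w hw l ℓ hℓ hvℓ hq j ρ ρbar hρbar χ
    (hχ.imp fun _ h ↦ h.1) red hred
  exact ⟨χ₀, hχ₀, hform, fun ν hν ↦ mt (hsplit ν hν)⟩
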